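/- Let $T$ be a complete first-order theory in a countable language whose set $S(T)$ of complete types in finitely many variables over $\varnothing$ has cardinality $2^{\omega}$. Let $\bar x$ be a finite tuple of variables and let $X$ be an uncountable set of complete types $p(\bar x)$ of $T$ with the uniform choice property: for every finite tuple $\bar y$ of variables and every formula $\varphi(\bar x,\bar y)$ there is a formula $\psi(\bar x,\bar y)$, not depending on $p$, such that for every $p\in X$ and every realization $\bar a$ of $p$ in a model of $T$, if $\varphi(\bar a,\bar y)$ is consistent, then $\psi(\bar a,\bar y)$ is a principal formula (that is, it is consistent and isolates a complete type over $\bar a$) and $\psi(\bar a,\bar y)\vdash\varphi(\bar a,\bar y)$. Then $P(T)=2^{\omega}$, where $P(T)$ is the number of isomorphism types of countable models of $T$ that are prime over some finite tuple of their elements. -/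

import Mathlib

universe u v w

open FirstOrder FirstOrder.Language Cardinal

namespace UnsmallTheory

variable {L : FirstOrder.Language.{u, v}}

/-- The class of unsmall theories: countable (that is, in a countable language) complete
theories whose set `S(T)` of complete types in finitely many variables over the empty set
has the cardinality of the continuum. -/
structure IsUnsmall (T : L.Theory) : Prop where
  countable : L.card ≤ ℵ₀
  complete : T.IsComplete
  card_types : #(Σ n : ℕ, T.CompleteType (Fin n)) = 𝔠

section Formulas

variable {M : Type w} [L.Structure M] {n m : ℕ}

/-- The formula `φ(a, y)` with parameters `a` from `M` is consistent (with `Th(M, a)`). -/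
def ConsistentOver (a : Fin n → M) (φ : L.Formula (Fin n ⊕ Fin m)) : Prop :=
  ∃ b : Fin m → M, φ.Realize (Sum.elim a b)

/-- `ψ(a, y) ⊢ φ(a, y)` (modulo `Th(M, a)`). -/
def ImpliesOver (a : Fin n → M) (ψ φ : L.Formula (Fin n ⊕ Fin m)) : Prop :=
  ∀ b : Fin m → M, ψ.Realize (Sum.elim a b) → φ.Realize (Sum.elim a b)

/-- `ψ(a, y)` is a principal formula: it is consistent, and it isolates a complete type
over `a`, i.e. it implies every formula `θ(a, y)` or its negation. -/
def PrincipalOver (a : Fin n → M) (ψ : L.Formula (Fin n ⊕ Fin m)) : Prop :=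
  ConsistentOver a ψ ∧
    ∀ θ : L.Formula (Fin n ⊕ Fin m), ImpliesOver a ψ θ ∨ ImpliesOver a ψ θ.not

/-- The structure `M` is prime over its tuple `a`: it embeds elementarily, over `a`, into every
structure `N` with a tuple `b` that satisfies the same formulas as `a` (equivalently, `(M, a)`
embeds elementarily into every model of `Th(M, a)`). -/
def IsPrimeOver (L : FirstOrder.Language.{u, v}) {M : Type w} [L.Structure M] {n : ℕ}
    (a : Fin n → M) : Prop :=
  ∀ (N : Type w) [L.Structure N] (b : Fin n → N),
    (∀ φ : L.Formula (Fin n), φ.Realize a ↔ φ.Realize b) →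
      ∃ f : M ↪ₑ[L] N, ∀ i, f (a i) = b i

end Formulas

/-- The uniform choice property of a set `X` of complete `n`-types: for every formula `φ(x, y)`
there is a formula `ψ(x, y)`, the same for all `p ∈ X`, such that whenever `a` realizes
some `p ∈ X` and `φ(a, y)` is consistent, `ψ(a, y)` is principal and `ψ(a, y) ⊢ φ(a, y)`. -/
def UniformChoice (T : L.Theory) {n : ℕ} (X : Set (T.CompleteType (Fin n))) : Prop :=
  ∀ (m : ℕ) (φ : L.Formula (Fin n ⊕ Fin m)), ∃ ψ : L.Formula (Fin n ⊕ Fin m),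
    ∀ p ∈ X, ∀ (M : Theory.ModelType.{u, v, 0} T) (a : Fin n → M), T.typeOf a = p →
      ConsistentOver a φ → PrincipalOver a ψ ∧ ImpliesOver a ψ φ

/-- Isomorphism of models of `T`. -/
def isoSetoid (T : L.Theory) : Setoid (Theory.ModelType.{u, v, 0} T) where
  r M N := Nonempty (M ≃[L] N)
  iseqv :=
    { refl := fun M => ⟨FirstOrder.Language.Equiv.refl L M⟩
      symm := fun ⟨f⟩ => ⟨f.symm⟩
      trans := fun ⟨f⟩ ⟨g⟩ => ⟨g.comp f⟩ }

/-- The set `P(T)` of isomorphism types of countable models of `T` that are prime over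
some finite tuple of their elements. -/
def primeModels (T : L.Theory) : Set (Quotient (isoSetoid T)) :=
  {c | ∃ M : Theory.ModelType.{u, v, 0} T, Quotient.mk (isoSetoid T) M = c ∧ Countable M ∧
    ∃ (n : ℕ) (a : Fin n → M), IsPrimeOver L a}

end UnsmallTheory

/-! For fixed φ, ψ, θ, the demand made by uniform choice is a single formula in x, so it holds on a
closed set of types. The property therefore passes from X to its closure (`uniformChoice_closure`),
which is an uncountable closed subset of a Polish space and so contains 2^ω types.

Over a realization of such a type the isolated types are dense, so Vaught's construction gives a
countable prime model (`exists_primeModel_realizing`). A countable model has only countably many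
n-tuples, hence accounts for countably many of these types; so there are 2^ω isomorphism classes.
Conversely, a countable model is determined by the formulas true of an enumeration of it, which
bounds their number by 2^ω. -/

namespace UnsmallTheory

/-! ### Building sequences by finite approximation -/

section Sequences

/-- Dependent choice for sequences: finite sequences satisfying `P` can be extended by an element
satisfying the requirement `Q`. -/
theorem exists_seq_of_forall_extension {M : Type*} [Nonempty M] (P : ∀ k, (Fin k → M) → Prop)
    (Q : ∀ k, (Fin k → M) → M → Prop) (h0 : ∀ f, P 0 f)
    (hs : ∀ k f, P k f → ∃ z, Q k f z ∧ P (k + 1) (Fin.snoc f z : Fin (k + 1) → M)) :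
    ∃ f : ℕ → M, ∀ k, P k (fun i => f i) ∧ Q k (fun i => f i) (f k) := by
  choose! g hQ hP using hs
  let s : ∀ k, Fin k → M := fun k => Nat.rec Fin.elim0 (fun k f => Fin.snoc f (g k f)) k
  have hs : ∀ k, s k = fun i : Fin k => g i (s i) := by
    intro k
    induction k with
    | zero => funext i; exact i.elim0
    | succ k ih =>
      funext i
      have h1 : s (k + 1) = Fin.snoc (s k) (g k (s k)) := rfl
      refine Fin.lastCases ?_ (fun i => ?_) i
      · rw [h1, Fin.snoc_last]; rfl
      · rw [h1, Fin.snoc_castSucc]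
        exact congrFun ih i
  have hPs : ∀ k, P k (s k) := by
    intro k
    induction k with
    | zero => exact h0 _
    | succ k ih => exact hP k _ ih
  refine ⟨fun k => g k (s k), fun k => ?_⟩
  rw [← hs k]
  exact ⟨hPs k, hQ k _ (hPs k)⟩

end Sequences

/-! ### Elementary maps and equality of types -/

section Maps

variable {L : FirstOrder.Language.{u, v}} {M : Type*} {N : Type*} [L.Structure M] [L.Structure N]

theorem forall_realize_iff_of_imp {α : Type*} {e : α → M} {d : α → N}
    (h : ∀ φ : L.Formula α, φ.Realize e → φ.Realize d) (φ : L.Formula α) :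
    φ.Realize e ↔ φ.Realize d :=
  ⟨h φ, fun hd => by_contra fun he => (Formula.realize_not.1 (h φ.not (Formula.realize_not.2 he))) hd⟩

/-- A map between generating tuples with the same type extends to an elementary embedding. -/
theorem exists_elementaryEmbedding_of_surjective {ι : Type*} (e : ι → M)
    (he : Function.Surjective e) (d : ι → N)
    (h : ∀ φ : L.Formula ι, φ.Realize e ↔ φ.Realize d) :
    ∃ f : M ↪ₑ[L] N, ∀ i, f (e i) = d i := by
  have key : ∀ i j, e i = e j → d i = d j := fun i j hij => by
    have := (h (Term.equal (Term.var i) (Term.var j))).1 (by simpa using hij)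
    simpa using this
  have hr : ∀ x, e (Function.surjInv he x) = x := Function.surjInv_eq he
  refine ⟨⟨fun x => d (Function.surjInv he x), ?_⟩, fun i => key _ _ (hr _)⟩
  intro n φ x
  have := h (φ.relabel fun i => Function.surjInv he (x i))
  simp only [Formula.realize_relabel] at this
  have hx : e ∘ (fun i => Function.surjInv he (x i)) = x := funext fun i => hr _
  rw [hx] at this
  exact this.symm

theorem nonempty_equiv_of_surjective_elementaryEmbedding (f : M ↪ₑ[L] N)
    (hf : Function.Surjective f) : Nonempty (M ≃[L] N) :=
  ⟨{ _root_.Equiv.ofBijective f ⟨f.injective, hf⟩ with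
    map_fun' := fun g x => f.map_fun g x
    map_rel' := fun r x => f.map_rel r x }⟩

/-- A formula has finitely many free variables, so initial segments of `c` and `d` suffice. -/
theorem realize_iff_of_forall_initial {α : Type*} {a : α → M} {c : ℕ → M} {b : α → N} {d : ℕ → N}
    (h : ∀ k, ∀ φ : L.Formula (α ⊕ Fin k),
      φ.Realize (Sum.elim a fun i => c i) ↔ φ.Realize (Sum.elim b fun i => d i))
    (φ : L.Formula (α ⊕ ℕ)) : φ.Realize (Sum.elim a c) ↔ φ.Realize (Sum.elim b d) := by
  classical
  let k := φ.freeVarFinset.sup (Sum.elim (fun _ => 0) fun i => i + 1)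
  have hk : ∀ i, Sum.inr i ∈ φ.freeVarFinset → i < k := fun i hi =>
    Finset.le_sup (f := (Sum.elim (fun _ => 0) fun i => i + 1 : α ⊕ ℕ → ℕ)) hi
  let g : φ.freeVarFinset → α ⊕ Fin k := fun x =>
    match x with
    | ⟨Sum.inl i, _⟩ => Sum.inl i
    | ⟨Sum.inr i, hi⟩ => Sum.inr ⟨i, hk i hi⟩
  have h1 := h k (BoundedFormula.restrictFreeVar φ g)
  simp only [Formula.Realize] at h1 ⊢
  rw [BoundedFormula.realize_restrictFreeVar (Sum.elim a c),
    BoundedFormula.realize_restrictFreeVar (Sum.elim b d)] at h1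
  · exact h1
  · rintro ⟨i | i, hi⟩ <;> rfl
  · rintro ⟨i | i, hi⟩ <;> rfl

theorem typeOf_elementaryEmbedding {T : L.Theory} [Nonempty M] [M ⊨ T] [Nonempty N] [N ⊨ T]
    {α : Type*} (f : M ↪ₑ[L] N) (a : α → M) : T.typeOf (f ∘ a) = T.typeOf a := by
  refine SetLike.ext fun φ => ?_
  simp only [Theory.CompleteType.mem_typeOf, f.map_formula]

theorem typeOf_eq_typeOf_iff {T : L.Theory} [Nonempty M] [M ⊨ T] [Nonempty N] [N ⊨ T]
    {α : Type*} {a : α → M} {b : α → N} :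
    T.typeOf a = T.typeOf b ↔ ∀ φ : L.Formula α, φ.Realize a ↔ φ.Realize b := by
  refine ⟨fun h φ => ?_, fun h => SetLike.ext fun φ => ?_⟩
  · rw [← Theory.CompleteType.formula_mem_typeOf (T := T), h,
      Theory.CompleteType.formula_mem_typeOf]
  · simp only [Theory.CompleteType.mem_typeOf, h]

end Maps

/-! ### Isolated types and prime models -/

section Atomic

variable {L : FirstOrder.Language.{u, v}} {M : Type*} [L.Structure M] {n : ℕ}

/-- The isolated types over `a` are dense. -/
def DenselyIsolatedOver (L : FirstOrder.Language.{u, v}) {M : Type*} [L.Structure M] {n : ℕ}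
    (a : Fin n → M) : Prop :=
  ∀ (m : ℕ) (φ : L.Formula (Fin n ⊕ Fin m)), ConsistentOver a φ →
    ∃ ψ : L.Formula (Fin n ⊕ Fin m), PrincipalOver a ψ ∧ ImpliesOver a ψ φ

/-- The type of the tuple `b` over `a` is isolated. -/
def IsolatedOver (L : FirstOrder.Language.{u, v}) {M : Type*} [L.Structure M] {n m : ℕ}
    (a : Fin n → M) (b : Fin m → M) : Prop :=
  ∃ χ : L.Formula (Fin n ⊕ Fin m), PrincipalOver a χ ∧ χ.Realize (Sum.elim a b)

theorem sum_elim_comp_lastCases {n j k : ℕ} (a : Fin n → M) (b : Fin k → M) (z : M)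
    (g : Fin j → Fin k) :
    (Sum.elim a (Fin.snoc b z : Fin (k + 1) → M)) ∘
        (Sum.map id (Fin.lastCases (Fin.last k) fun i => (g i).castSucc) :
          Fin n ⊕ Fin (j + 1) → Fin n ⊕ Fin (k + 1)) =
      Sum.elim a (Fin.snoc (b ∘ g) z : Fin (j + 1) → M) := by
  funext i
  rcases i with i | i
  · rfl
  · refine Fin.lastCases ?_ (fun i => ?_) i <;> simp

/-- A principal ψ below χ ∧ φ projects to a formula consistent with χ. Since χ is principal it
implies this projection, so `b` itself extends to a realization of ψ. -/
theorem IsolatedOver.exists_snoc {a : Fin n → M} (ha : DenselyIsolatedOver L a) {k : ℕ}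
    {b : Fin k → M} (hb : IsolatedOver L a b) (φ : L.Formula (Fin n ⊕ Fin (k + 1)))
    (hφ : ∃ z, φ.Realize (Sum.elim a (Fin.snoc b z : Fin (k + 1) → M))) :
    ∃ z, φ.Realize (Sum.elim a (Fin.snoc b z : Fin (k + 1) → M)) ∧
      IsolatedOver L a (Fin.snoc b z : Fin (k + 1) → M) := by
  obtain ⟨χ, hχ, hχb⟩ := hb
  obtain ⟨z, hz⟩ := hφ
  have comp : ∀ w : Fin (k + 1) → M,
      Sum.elim a w ∘ Sum.map id Fin.castSucc = Sum.elim a (w ∘ Fin.castSucc) := fun w => by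
    funext i; rcases i with i | i <;> rfl
  have hsnoc : ∀ z, (Fin.snoc b z : Fin (k + 1) → M) ∘ Fin.castSucc = b := fun z => by
    funext i; simp
  obtain ⟨ψ, hψ, hψφ⟩ := ha (k + 1) (χ.relabel (Sum.map id Fin.castSucc) ⊓ φ)
    ⟨Fin.snoc b z, by
      rw [Formula.realize_inf, Formula.realize_relabel, comp, hsnoc]
      exact ⟨hχb, hz⟩⟩
  let g : Fin n ⊕ Fin (k + 1) → (Fin n ⊕ Fin k) ⊕ Fin 1 :=
    Sum.elim (fun i => Sum.inl (Sum.inl i))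
      (Fin.lastCases (Sum.inr 0) fun i => Sum.inl (Sum.inr i))
  have hg : ∀ (b : Fin k → M) (y : Fin 1 → M), Sum.elim (Sum.elim a b) y ∘ g =
      Sum.elim a (Fin.snoc b (y 0) : Fin (k + 1) → M) := by
    intro b y
    funext i
    rcases i with i | i
    · rfl
    · refine Fin.lastCases ?_ (fun i => ?_) i <;> simp [g]
  let θ : L.Formula (Fin n ⊕ Fin k) := (ψ.relabel g).iExs (Fin 1)
  have hθ : ∀ b : Fin k → M, θ.Realize (Sum.elim a b) ↔
      ∃ z, ψ.Realize (Sum.elim a (Fin.snoc b z : Fin (k + 1) → M)) := by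
    intro b
    simp only [θ, Formula.realize_iExs, Formula.realize_relabel, hg]
    exact ⟨fun ⟨y, hy⟩ => ⟨_, hy⟩, fun ⟨z, hz⟩ => ⟨fun _ => z, hz⟩⟩
  have himp : ImpliesOver a χ θ := by
    refine (hχ.2 θ).resolve_right fun hn => ?_
    obtain ⟨w, hw⟩ := hψ.1
    have h1 := (Formula.realize_inf.1 (hψφ w hw)).1
    rw [Formula.realize_relabel, comp] at h1
    refine Formula.realize_not.1 (hn _ h1) ((hθ _).2 ⟨w (Fin.last k), ?_⟩)
    have : (Fin.snoc (w ∘ Fin.castSucc) (w (Fin.last k)) : Fin (k + 1) → M) = w :=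
      Fin.snoc_init_self w
    rwa [this]
  obtain ⟨z', hz'⟩ := (hθ b).1 (himp b hχb)
  exact ⟨z', (Formula.realize_inf.1 (hψφ _ hz')).2, ψ, hψ, hz'⟩

theorem isolatedOver_zero {a : Fin n → M} (b : Fin 0 → M)
    (ha : DenselyIsolatedOver L a) : IsolatedOver L a b := by
  obtain ⟨ψ, hψ, -⟩ := ha 0 ⊤ ⟨b, Formula.realize_top.2 trivial⟩
  obtain ⟨w, hw⟩ := hψ.1
  exact ⟨ψ, hψ, by rwa [Subsingleton.elim b w]⟩

/-- If the isolated types over `a` are dense, some sequence with isolated initial segments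
witnesses every formula with parameters in `a` and the sequence. -/
theorem exists_isolated_seq [Countable L.Symbols] [Nonempty M] {a : Fin n → M}
    (ha : DenselyIsolatedOver L a) :
    ∃ c : ℕ → M, (∀ k, IsolatedOver L a fun i : Fin k => c i) ∧
      ∀ (j : ℕ) (φ : L.Formula (Fin n ⊕ Fin (j + 1))),
        (∃ z, φ.Realize (Sum.elim a (Fin.snoc (fun i : Fin j => c i) z : Fin (j + 1) → M))) →
        ∃ k, φ.Realize (Sum.elim a (Fin.snoc (fun i : Fin j => c i) (c k) : Fin (j + 1) → M)) := by
  have : Nonempty (Σ j, L.Formula (Fin n ⊕ Fin (j + 1))) := ⟨⟨0, ⊤⟩⟩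
  obtain ⟨e, he⟩ := exists_surjective_nat (Σ j, L.Formula (Fin n ⊕ Fin (j + 1)))
  -- Stage `k` treats formula number `k.unpair.1`, provided its parameters are among the terms
  -- already built.
  let Q : ∀ k, (Fin k → M) → M → Prop := fun k f z =>
    ∀ h : (e k.unpair.1).1 ≤ k,
      (∃ z, (e k.unpair.1).2.Realize (Sum.elim a (Fin.snoc (f ∘ Fin.castLE h) z : Fin (_ + 1) → M))) →
      (e k.unpair.1).2.Realize (Sum.elim a (Fin.snoc (f ∘ Fin.castLE h) z : Fin (_ + 1) → M))
  obtain ⟨c, hc⟩ := exists_seq_of_forall_extension (fun k f => IsolatedOver L a f) Q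
    (fun f => isolatedOver_zero f ha) (by
      intro k f hf
      by_cases h : ∃ h : (e k.unpair.1).1 ≤ k, ∃ z, (e k.unpair.1).2.Realize
          (Sum.elim a (Fin.snoc (f ∘ Fin.castLE h) z : Fin (_ + 1) → M))
      · obtain ⟨h, z, hz⟩ := h
        obtain ⟨z', hz', hi⟩ := hf.exists_snoc ha
          ((e k.unpair.1).2.relabel (Sum.map id
            (Fin.lastCases (Fin.last k) fun i => (Fin.castLE h i).castSucc)))
          ⟨z, by rwa [Formula.realize_relabel, sum_elim_comp_lastCases]⟩
        rw [Formula.realize_relabel, sum_elim_comp_lastCases] at hz'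
        exact ⟨z', fun _ _ => hz', hi⟩
      · obtain ⟨z', -, hi⟩ := hf.exists_snoc ha ⊤ ⟨Classical.arbitrary M, Formula.realize_top.2 trivial⟩
        exact ⟨z', fun h1 h2 => (h ⟨h1, h2⟩).elim, hi⟩)
  refine ⟨c, fun k => (hc k).1, fun j φ hφ => ?_⟩
  obtain ⟨i, hi⟩ := he ⟨j, φ⟩
  -- This stage treats formula `i` and is at least `j`, so the `j` parameters exist by then.
  refine ⟨Nat.pair i j, ?_⟩
  have h := (hc (Nat.pair i j)).2
  have hij : e (Nat.pair i j).unpair.1 = ⟨j, φ⟩ := by rw [Nat.unpair_pair, hi]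
  simp only [Q] at h
  rw [hij] at h
  exact h (Nat.right_le_pair i j) hφ

/-- This feeds the Tarski–Vaught test: the finitely many parameters defining `D` lie in one initial
segment of `c`. -/
theorem meetsDefinable_range_of_witnesses {a : Fin n → M} {c : ℕ → M}
    (hc : ∀ (j : ℕ) (φ : L.Formula (Fin n ⊕ Fin (j + 1))),
        (∃ z, φ.Realize (Sum.elim a (Fin.snoc (fun i : Fin j => c i) z : Fin (j + 1) → M))) →
        ∃ k, φ.Realize (Sum.elim a (Fin.snoc (fun i : Fin j => c i) (c k) : Fin (j + 1) → M))) :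
    L.MeetsDefinable (Set.range c) := by
  classical
  rintro D ⟨x, hx⟩ hD
  obtain ⟨φ, hφ⟩ := Set.definable_iff_exists_formula_sum.1 hD
  have hφ' : ∀ y : M, y ∈ D ↔
      φ.Realize (Sum.elim (fun s : Set.range c => (s : M)) fun _ : Fin 1 => y) :=
    fun y => Set.ext_iff.1 hφ fun _ => y
  choose ι hι using fun s : Set.range c => s.2
  let j := φ.freeVarFinset.sup (Sum.elim (fun s => ι s + 1) fun _ => 0)
  have hj : ∀ s, Sum.inl s ∈ φ.freeVarFinset → ι s < j := fun s hs =>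
    Finset.le_sup (f := (Sum.elim (fun s => ι s + 1) fun _ => 0 : Set.range c ⊕ Fin 1 → ℕ)) hs
  let g : φ.freeVarFinset → Fin n ⊕ Fin (j + 1) := fun x =>
    match x with
    | ⟨Sum.inl s, hs⟩ => Sum.inr (Fin.castSucc ⟨ι s, hj s hs⟩)
    | ⟨Sum.inr _, _⟩ => Sum.inr (Fin.last j)
  have hg : ∀ y : M, y ∈ D ↔ Formula.Realize (BoundedFormula.restrictFreeVar φ g)
      (Sum.elim a (Fin.snoc (fun i : Fin j => c i) y : Fin (j + 1) → M)) := by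
    intro y
    rw [hφ', Formula.Realize, Formula.Realize]
    refine (BoundedFormula.realize_restrictFreeVar _ ?_).symm
    rintro ⟨s | s, hs⟩
    · exact (Fin.snoc_castSucc (α := fun _ => M) y (fun i : Fin j => c i) ⟨ι s, hj s hs⟩).trans (hι s)
    · simp [g]
  obtain ⟨k, hk⟩ := hc j _ ⟨x, (hg x).1 hx⟩
  exact ⟨c k, (hg _).2 hk, k, rfl⟩

theorem mem_range_of_witnesses {a : Fin n → M} {c : ℕ → M}
    (hc : ∀ (j : ℕ) (φ : L.Formula (Fin n ⊕ Fin (j + 1))),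
        (∃ z, φ.Realize (Sum.elim a (Fin.snoc (fun i : Fin j => c i) z : Fin (j + 1) → M))) →
        ∃ k, φ.Realize (Sum.elim a (Fin.snoc (fun i : Fin j => c i) (c k) : Fin (j + 1) → M)))
    (i : Fin n) : ∃ k, c k = a i := by
  obtain ⟨k, hk⟩ := hc 0 (Term.equal (Term.var (Sum.inr (Fin.last 0))) (Term.var (Sum.inl i)))
    ⟨a i, by simp [Fin.snoc]⟩
  exact ⟨k, by simpa [Fin.snoc] using hk⟩

/-- The formula ∀y (χ → θ) has only x free, so its truth transfers from `a` to `b`. -/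
theorem realize_iff_of_realize_principal {N : Type*} [L.Structure N] {m : ℕ} {a : Fin n → M}
    {b : Fin n → N} (hab : ∀ φ : L.Formula (Fin n), φ.Realize a ↔ φ.Realize b)
    {χ : L.Formula (Fin n ⊕ Fin m)} (hχ : PrincipalOver a χ) {x : Fin m → M} {y : Fin m → N}
    (hx : χ.Realize (Sum.elim a x)) (hy : χ.Realize (Sum.elim b y))
    (θ : L.Formula (Fin n ⊕ Fin m)) :
    θ.Realize (Sum.elim a x) ↔ θ.Realize (Sum.elim b y) := by
  refine forall_realize_iff_of_imp (fun θ hθ => ?_) θ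
  have himp : ImpliesOver a χ θ :=
    (hχ.2 θ).resolve_right fun hn => Formula.realize_not.1 (hn x hx) hθ
  have h1 : ((χ.imp θ).iAlls (Fin m)).Realize a :=
    Formula.realize_iAlls.2 fun w => Formula.realize_imp.2 (himp w)
  exact Formula.realize_imp.1 (Formula.realize_iAlls.1 ((hab _).1 h1) y) hy

/-- A sequence with isolated initial segments over `a` can be copied over any tuple with the same
type as `a`. -/
theorem exists_seq_realize_iff {N : Type*} [L.Structure N] [Nonempty N] {a : Fin n → M}
    {b : Fin n → N} (hab : ∀ φ : L.Formula (Fin n), φ.Realize a ↔ φ.Realize b) {c : ℕ → M}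
    (hc : ∀ k, IsolatedOver L a fun i : Fin k => c i) :
    ∃ d : ℕ → N, ∀ φ : L.Formula (Fin n ⊕ ℕ),
      φ.Realize (Sum.elim a c) ↔ φ.Realize (Sum.elim b d) := by
  obtain ⟨d, hd⟩ := exists_seq_of_forall_extension (M := N)
    (fun k f => ∀ φ : L.Formula (Fin n ⊕ Fin k),
      φ.Realize (Sum.elim a fun i => c i) ↔ φ.Realize (Sum.elim b f)) (fun _ _ _ => True)
    (by
      intro f φ
      have h := hab (φ.relabel (Sum.elim id Fin.elim0))
      simp only [Formula.realize_relabel] at h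
      convert h using 2 <;>
      · funext i
        rcases i with i | i
        · rfl
        · exact i.elim0)
    (by
      intro k f hf
      obtain ⟨χ, hχ, hχc⟩ := hc (k + 1)
      let g : Fin n ⊕ Fin (k + 1) → (Fin n ⊕ Fin k) ⊕ Fin 1 :=
        Sum.elim (fun i => Sum.inl (Sum.inl i))
          (Fin.lastCases (Sum.inr 0) fun i => Sum.inl (Sum.inr i))
      have h1 : ((χ.relabel g).iExs (Fin 1)).Realize (Sum.elim a fun i : Fin k => c i) := by
        refine Formula.realize_iExs.2 ⟨fun _ => c k, ?_⟩
        rw [Formula.realize_relabel]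
        convert hχc using 2
        funext i
        rcases i with i | i
        · rfl
        · refine Fin.lastCases ?_ (fun i => ?_) i <;> simp [g]
      obtain ⟨y, hy⟩ := Formula.realize_iExs.1 ((hf _).1 h1)
      refine ⟨y 0, trivial, realize_iff_of_realize_principal hab hχ hχc ?_⟩
      rw [Formula.realize_relabel] at hy
      convert hy using 2
      funext i
      rcases i with i | i
      · rfl
      · refine Fin.lastCases ?_ (fun i => ?_) i <;> simp [g])
  exact ⟨d, realize_iff_of_forall_initial fun k => (hd k).1⟩

/-- If the isolated types over `a` are dense, there is a countable elementary substructure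
that is prime over `a`. -/
theorem exists_countable_prime_substructure [Countable L.Symbols] {M : Type w} [L.Structure M]
    [Nonempty M] {a : Fin n → M} (ha : DenselyIsolatedOver L a) :
    ∃ (S : L.ElementarySubstructure M) (a' : Fin n → S), Countable S ∧ S.subtype ∘ a' = a ∧
      IsPrimeOver L a' := by
  obtain ⟨c, hiso, hwit⟩ := exists_isolated_seq ha
  have hA := meetsDefinable_range_of_witnesses hwit
  let S : L.ElementarySubstructure M := hA.toElementarySubstructure
  have hS : ∀ x, x ∈ S ↔ x ∈ Set.range c := fun x => Set.ext_iff.1 hA.closure_eq_self x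
  let c' : ℕ → S := fun k => ⟨c k, (hS _).2 ⟨k, rfl⟩⟩
  have hc' : Function.Surjective c' := by
    rintro ⟨x, hx⟩
    obtain ⟨k, rfl⟩ := (hS x).1 hx
    exact ⟨k, rfl⟩
  let a' : Fin n → S := fun i => ⟨a i, (hS _).2 (mem_range_of_witnesses hwit i)⟩
  refine ⟨S, a', hc'.countable, rfl, fun N _ b hab => ?_⟩
  have hsub : ∀ φ : L.Formula (Fin n), φ.Realize a ↔ φ.Realize b := fun φ => by
    rw [← hab φ, ← S.subtype.map_formula]
    rfl
  obtain ⟨x⟩ := (inferInstance : Nonempty S)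
  -- `IsPrimeOver` does not assume `N` nonempty; the formula ∃y ⊤, true of `a`, transfers to `b`.
  have hN : Nonempty N := by
    have h1 := (hsub ((⊤ : L.Formula (Fin n ⊕ Fin 1)).iExs (Fin 1))).1
      (Formula.realize_iExs.2 ⟨fun _ => x, Formula.realize_top.2 trivial⟩)
    obtain ⟨y, -⟩ := Formula.realize_iExs.1 h1
    exact ⟨y 0⟩
  obtain ⟨d, hd⟩ := exists_seq_realize_iff hsub hiso
  -- Although `c'` alone is onto, `a'` is included so that the embedding sends it to `b`.
  obtain ⟨f, hf⟩ := exists_elementaryEmbedding_of_surjective (L := L) (Sum.elim a' c')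
    (fun x => by obtain ⟨k, rfl⟩ := hc' x; exact ⟨Sum.inr k, rfl⟩) (Sum.elim b d) (fun φ => by
      rw [← hd φ, ← S.subtype.map_formula]
      have : S.subtype ∘ Sum.elim a' c' = Sum.elim a c := by
        funext i; rcases i with i | i <;> rfl
      rw [this])
  exact ⟨f, fun i => hf (Sum.inl i)⟩

end Atomic

/-! ### The space of types and uniform choice -/

section Types

variable {L : FirstOrder.Language.{u, v}} {T : L.Theory} {n : ℕ}

/-- The formula in `x` stating that if `φ(x, y)` is consistent, then `ψ(x, y)` is consistent,
implies `φ(x, y)` and decides `θ(x, y)`. -/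
noncomputable def choiceFormula {m : ℕ} (φ ψ θ : L.Formula (Fin n ⊕ Fin m)) : L.Formula (Fin n) :=
  (φ.iExs (Fin m)).imp (ψ.iExs (Fin m) ⊓ ((ψ.imp φ).iAlls (Fin m) ⊓
    ((ψ.imp θ).iAlls (Fin m) ⊔ (ψ.imp θ.not).iAlls (Fin m))))

theorem realize_choiceFormula {M : Type*} [L.Structure M] {m : ℕ}
    {φ ψ θ : L.Formula (Fin n ⊕ Fin m)} {a : Fin n → M} :
    (choiceFormula φ ψ θ).Realize a ↔ (ConsistentOver a φ → ConsistentOver a ψ ∧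
      ImpliesOver a ψ φ ∧ (ImpliesOver a ψ θ ∨ ImpliesOver a ψ θ.not)) := by
  simp only [choiceFormula, Formula.realize_imp, Formula.realize_inf, Formula.realize_sup,
    Formula.realize_iExs, Formula.realize_iAlls]
  rfl

/-- Every complete type in a countable language is realized in a countable model. -/
theorem exists_countable_model_typeOf_eq [Countable L.Symbols] (p : T.CompleteType (Fin n)) :
    ∃ (M : Theory.ModelType.{u, v, 0} T) (a : Fin n → M), Countable M ∧ T.typeOf a = p := by
  obtain ⟨M, a, ha⟩ := Theory.exists_modelType_is_realized_in T p
  obtain ⟨S, hS, hSc⟩ : ∃ S : L.ElementarySubstructure M, Set.range a ⊆ S ∧ Countable S := by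
    -- Löwenheim–Skolem to size exactly ℵ₀ needs an infinite model; a finite one is already
    -- countable.
    rcases finite_or_infinite M with h | h
    · exact ⟨⊤, fun _ _ => ElementarySubstructure.mem_top _, inferInstance⟩
    · have hL : L.card ≤ ℵ₀ := mk_le_aleph0_iff.2 inferInstance
      obtain ⟨S, h1, h2⟩ := exists_elementarySubstructure_card_eq L (Set.range a)
        (ℵ₀ : Cardinal.{0}) le_rfl
        (by simp)
        (by simpa using hL) (by simp)
      refine ⟨S, h1, ?_⟩
      rw [← mk_le_aleph0_iff]
      simp at h2
      exact h2.le
  -- Countability allows `S` to be copied into universe 0, where the models being counted live.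
  have : Small.{0} S := Countable.toSmall _
  let M' : Theory.ModelType.{u, v, 0} T := Theory.ModelType.equivInduced
    (M := S.toModel T) (equivShrink S)
  let e : S ≃[L] M' := (equivShrink S).inducedStructureEquiv
  let a' : Fin n → S := fun i => ⟨a i, hS ⟨i, rfl⟩⟩
  refine ⟨M', e ∘ a', ?_, ?_⟩
  · exact e.symm.injective.countable
  · rw [← ha]
    rw [typeOf_eq_typeOf_iff]
    intro φ
    have h1 := e.toElementaryEmbedding.map_formula φ a'
    have h2 := S.subtype.map_formula φ a'
    exact h1.trans h2.symm

theorem uniformChoice_closure [Countable L.Symbols] {X : Set (T.CompleteType (Fin n))}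
    (hX : UniformChoice T X) : UniformChoice T (closure X) := by
  intro m φ
  obtain ⟨ψ, hψ⟩ := hX m φ
  have hmem : ∀ θ, ∀ p ∈ closure X, Formula.equivSentence (choiceFormula φ ψ θ) ∈ p := by
    intro θ
    refine closure_minimal (t := T.typesWith (Formula.equivSentence (choiceFormula φ ψ θ)))
      (fun p hp => ?_) (CompleteType.isClosed_typesWith _)
    obtain ⟨M, a, -, ha⟩ := exists_countable_model_typeOf_eq p
    rw [Theory.CompleteType.mem_typesWith_iff, ← ha, Theory.CompleteType.formula_mem_typeOf,
      realize_choiceFormula]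
    intro hc
    obtain ⟨h1, h2⟩ := hψ p hp M a ha hc
    exact ⟨h1.1, h2, h1.2 θ⟩
  refine ⟨ψ, fun p hp M a ha hc => ?_⟩
  have h : ∀ θ, _ := fun θ => by
    have := hmem θ p hp
    rw [← ha, Theory.CompleteType.formula_mem_typeOf, realize_choiceFormula] at this
    exact this hc
  -- Only the last clause depends on θ, so any θ, here ⊤, yields the others.
  exact ⟨⟨(h ⊤).1, fun θ => (h θ).2.2⟩, (h ⊤).2.1⟩

instance secondCountableTopology_completeType [Countable L.Symbols] {α : Type*} [Countable α] :
    SecondCountableTopology (T.CompleteType α) := by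
  refine CompleteType.isTopologicalBasis_range_typesWith.secondCountableTopology ?_
  have : Countable L[[α]].Sentence := inferInstanceAs (Countable (L[[α]].Formula Empty))
  exact Set.countable_range _

instance polishSpace_completeType [Countable L.Symbols] {α : Type*} [Countable α] :
    PolishSpace (T.CompleteType α) := by
  let := TopologicalSpace.metrizableSpaceMetric (T.CompleteType α)
  infer_instance

theorem exists_primeModel_realizing [Countable L.Symbols] {X : Set (T.CompleteType (Fin n))}
    (hX : UniformChoice T X) {p : T.CompleteType (Fin n)} (hp : p ∈ X) :
    ∃ (M : Theory.ModelType.{u, v, 0} T) (a : Fin n → M), Countable M ∧ T.typeOf a = p ∧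
      IsPrimeOver L a := by
  obtain ⟨M, a, -, ha⟩ := exists_countable_model_typeOf_eq p
  have hd : DenselyIsolatedOver L a := fun m φ hφ => by
    obtain ⟨ψ, hψ⟩ := hX m φ
    exact ⟨ψ, hψ p hp M a ha hφ⟩
  obtain ⟨S, a', hS, haa, hprime⟩ := exists_countable_prime_substructure hd
  refine ⟨S.toModel T, a', hS, ?_, hprime⟩
  rw [← ha, ← haa]
  exact (typeOf_eq_typeOf_iff (M := S.toModel T)).2 fun φ => (S.subtype.map_formula φ a').symm

end Types

/-! ### Counting prime models -/

section Counting

variable {L : FirstOrder.Language.{u, v}} {T : L.Theory} {n : ℕ}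

theorem mk_primeModels_le [Countable L.Symbols] : #(primeModels T) ≤ 𝔠 := by
  choose M hM hc _ using fun c : primeModels T => c.2
  choose e he using fun c : primeModels T => haveI := hc c; exists_surjective_nat (M c)
  let F : primeModels T → Set (L.Formula ℕ) := fun c => {φ | φ.Realize (e c)}
  have hF : Function.Injective F := by
    intro c d hcd
    obtain ⟨f, hf⟩ := exists_elementaryEmbedding_of_surjective (L := L) (e c) (he c) (e d)
      (fun φ => Set.ext_iff.1 hcd φ)
    refine Subtype.ext ?_
    rw [← hM c, ← hM d]
    refine Quotient.sound (nonempty_equiv_of_surjective_elementaryEmbedding f fun y => ?_)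
    obtain ⟨i, rfl⟩ := he d y
    exact ⟨e c i, hf i⟩
  have h := lift_mk_le_lift_mk_of_injective hF
  have h2 : #(Set (L.Formula ℕ)) ≤ 𝔠 := by
    rw [mk_set, ← two_power_aleph0]
    exact power_le_power_left two_ne_zero (mk_le_aleph0_iff.2 inferInstance)
  have h3 := h.trans (lift_le.2 h2)
  rw [lift_continuum, lift_le_continuum] at h3
  exact h3

theorem continuum_le_mk_primeModels [Countable L.Symbols] {X : Set (T.CompleteType (Fin n))}
    (hX : ¬ X.Countable) (hchoice : UniformChoice T X) : 𝔠 ≤ #(primeModels T) := by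
  obtain ⟨f, hfX, -, hf⟩ := isClosed_closure.exists_nat_bool_injection_of_not_countable
    (C := closure X) fun h => hX (h.mono subset_closure)
  choose M a hM ha hprime using fun s => exists_primeModel_realizing (uniformChoice_closure hchoice)
    (hfX ⟨s, rfl⟩ : f s ∈ closure X)
  let F : (ℕ → Bool) → primeModels T := fun s =>
    ⟨Quotient.mk (isoSetoid T) (M s), M s, rfl, hM s, n, a s, hprime s⟩
  -- One representative per class: tuples from isomorphic models are moved into the same `R c` and
  -- coded there by natural numbers.
  choose R hR hRc _ using fun c : primeModels T => c.2
  have hiso : ∀ s, Nonempty (M s ≃[L] R (F s)) := fun s =>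
    (Quotient.exact (hR (F s)).symm : (isoSetoid T).r (M s) (R (F s)))
  let g : ∀ s, M s ≃[L] R (F s) := fun s => (hiso s).some
  choose code hcode using fun c : primeModels T =>
    haveI := hRc c; exists_injective_nat (Fin n → R c)
  -- The class and the code determine the moved tuple, hence its type `f s`, hence `s`.
  let G : (ℕ → Bool) → primeModels T × ℕ := fun s => (F s, code (F s) (g s ∘ a s))
  have hg : ∀ s, T.typeOf (g s ∘ a s) = f s := fun s =>
    (typeOf_elementaryEmbedding (g s).toElementaryEmbedding (a s)).trans (ha s)
  have hG : Function.Injective G := by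
    intro s t hst
    apply hf
    have h1 : F s = F t := congrArg Prod.fst hst
    have h2 : code (F s) (g s ∘ a s) = code (F t) (g t ∘ a t) := congrArg Prod.snd hst
    rw [← hg s, ← hg t]
    generalize (g s ∘ a s) = x at h2
    generalize (g t ∘ a t) = y at h2
    generalize F s = c at *
    subst h1
    rw [hcode _ h2]
  have h := lift_mk_le_lift_mk_of_injective hG
  have h1 : 𝔠 ≤ #(primeModels T) * ℵ₀ := by simpa using h
  by_contra hlt
  exact absurd h1 (not_le.2 (mul_lt_of_lt aleph0_le_continuum (not_le.1 hlt) aleph0_lt_continuum))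

end Counting

end UnsmallTheory

theorem proposition5p5 {L : FirstOrder.Language.{u, v}} (T : L.Theory)
    (hT : UnsmallTheory.IsUnsmall T) (n : ℕ) (X : Set (T.CompleteType (Fin n)))
    (hX : ¬ X.Countable) (hchoice : UnsmallTheory.UniformChoice T X) :
    Cardinal.mk (UnsmallTheory.primeModels T) = Cardinal.continuum := by
  have : Countable L.Symbols := mk_le_aleph0_iff.1 hT.countable
  exact le_antisymm UnsmallTheory.mk_primeModels_le
    (UnsmallTheory.continuum_le_mk_primeModels hX hchoice)
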